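/- For integers $p\ge 1$, $n\ge 1$ let $H_n^{(p)}=\sum_{k=1}^n k^{-p}$, and for positive integers $\pi_1,\dots,\pi_m$ and an integer $q\ge2$ let $$S_{\pi_1\cdots\pi_m,q}=\sum_{n=1}^\infty \frac{H_n^{(\pi_1)}\cdots H_n^{(\pi_m)}}{n^q},$$ where repeated indices are written as powers (so $S_{r^2,q}$ has numerator $(H_n^{(r)})^2$). The sums $S_{p,q}$ with $m=1$ are called linear. A polynomial in zeta values is an element of the $\mathbb{Q}$-algebra $\mathcal{Z}\subset\mathbb{R}$ generated by the numbers $\zeta(s)=\sum_{n\ge1}n^{-s}$, $s=2,3,4,\dots$. Then for every integer $r\ge 2$: 1. $S_{r^2,r}=\tfrac13\zeta(r)^3-\tfrac13\zeta(3r)+S_{r,2r}$. 2. $S_{r^3,r}=\tfrac14\zeta(r)^4+\tfrac34\zeta(2r)^2+\zeta(4r)-S_{r,3r}+\tfrac32S_{r^2,2r}-\tfrac32S_{2r,2r}$. 3. Both $S_{r^2,r}$ and $S_{r^3,r}$ are reducible to linear sums and polynomials in zeta values: each is a finite sum $P_0+\sum_i P_i\,S_{p_i,q_i}$ with $P_0,P_i\in\mathcal{Z}$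 and integers $p_i\ge1$, $q_i\ge2$. 4. If $r\geq 3$ is odd, then $S_{r^2,r}\in\mathcal{Z}$, i.e. $S_{r^2,r}$ is a polynomial with rational coefficients in zeta values. -/

import Mathlib

noncomputable section

namespace EulerSums

/-- The generalized harmonic number `H_n^{(r)} = ∑_{k=1}^n 1 / k^r`. -/
def genHarmonic (r n : ℕ) : ℝ := ∑ k ∈ Finset.Icc 1 n, 1 / (k : ℝ) ^ r

/-- The Euler sum `S_{π,q} = ∑_{n ≥ 1} (∏_{p ∈ π} H_n^{(p)}) / n^q`, where the partition `π` is given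
as the multiset of its parts. It converges for `q ≥ 2` and positive parts, see
`summable_eulerSum`. -/
def eulerSum (π : Multiset ℕ) (q : ℕ) : ℝ :=
  ∑' n : ℕ, (π.map (fun p => genHarmonic p (n + 1))).prod / ((n : ℝ) + 1) ^ q

/-- The zeta value `ζ(s) = ∑_{n ≥ 1} 1 / n^s` as a real number (used for integers `s ≥ 2`). -/
def zetaValue (s : ℕ) : ℝ := ∑' n : ℕ, 1 / ((n : ℝ) + 1) ^ s

/-- The polynomials in zeta values: the `ℚ`-subalgebra of `ℝ` generated by the numbers `ζ(s)`,
`s ≥ 2`. -/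
def zetaAlgebra : Subalgebra ℚ ℝ := Algebra.adjoin ℚ {x : ℝ | ∃ s : ℕ, 2 ≤ s ∧ x = zetaValue s}

/-- The real numbers that are reducible to linear Euler sums and polynomials in zeta values:
the finite sums `P₀ + ∑ Pᵢ * S_{pᵢ,qᵢ}` with `pᵢ ≥ 1`, `qᵢ ≥ 2`, where `P₀` and the `Pᵢ` are
polynomials with rational coefficients in zeta values. -/
def linearReducible : Submodule zetaAlgebra ℝ :=
  Submodule.span zetaAlgebra
    ({1} ∪ {x : ℝ | ∃ p q : ℕ, 1 ≤ p ∧ 2 ≤ q ∧ x = eulerSum {p} q})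

/-- For `s ≥ 2` the real zeta value is the value of the Riemann zeta function. -/
theorem zetaValue_eq_riemannZeta (s : ℕ) (hs : 2 ≤ s) : (zetaValue s : ℂ) = riemannZeta s := by
  rw [zeta_eq_tsum_one_div_nat_add_one_cpow (by simp; omega)]
  unfold zetaValue
  push_cast
  refine tsum_congr fun n => ?_
  rw [Complex.cpow_natCast]

theorem genHarmonic_nonneg (p n : ℕ) : 0 ≤ genHarmonic p n :=
  Finset.sum_nonneg fun _ _ => by positivity

theorem genHarmonic_le (p n : ℕ) (hp : 1 ≤ p) : genHarmonic p n ≤ 1 + Real.log n := by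
  refine le_trans ?_ (harmonic_le_one_add_log n)
  rw [harmonic_eq_sum_Icc]
  push_cast
  refine Finset.sum_le_sum fun k hk => ?_
  have h1 : (1 : ℝ) ≤ k := by exact_mod_cast (Finset.mem_Icc.mp hk).1
  rw [one_div]
  exact inv_anti₀ (by linarith) (le_self_pow₀ h1 (by omega))

theorem prod_genHarmonic_bounds (π : Multiset ℕ) (hπ : ∀ p ∈ π, 1 ≤ p) (n : ℕ) :
    0 ≤ (π.map (fun p => genHarmonic p n)).prod ∧
      (π.map (fun p => genHarmonic p n)).prod ≤ (1 + Real.log n) ^ π.card := by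
  induction π using Multiset.induction_on with
  | empty => simp
  | cons a t ih =>
    obtain ⟨h0, h1⟩ := ih fun p hp => hπ p (Multiset.mem_cons_of_mem hp)
    have h2 := genHarmonic_nonneg a n
    have h3 := genHarmonic_le a n (hπ a (Multiset.mem_cons_self a t))
    simp only [Multiset.map_cons, Multiset.prod_cons, Multiset.card_cons]
    refine ⟨mul_nonneg h2 h0, ?_⟩
    rw [pow_succ']
    exact mul_le_mul h3 h1 h0 (h2.trans h3)

/-- The series defining an Euler sum converges for `q ≥ 2`. -/
theorem summable_eulerSum (π : Multiset ℕ) (hπ : ∀ p ∈ π, 1 ≤ p) (q : ℕ) (hq : 2 ≤ q) :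
    Summable fun n : ℕ =>
      (π.map (fun p => genHarmonic p (n + 1))).prod / ((n : ℝ) + 1) ^ q := by
  have hlog : (fun x : ℝ => (1 + Real.log x) ^ π.card) =O[Filter.atTop]
      fun x : ℝ => x ^ (1 / 2 : ℝ) := by
    have h1 : (fun x : ℝ => 1 + Real.log x) =O[Filter.atTop] Real.log :=
      (Real.isLittleO_const_log_atTop.isBigO).add (Asymptotics.isBigO_refl _ _)
    refine (h1.pow π.card).trans ?_
    have h2 := (isLittleO_log_rpow_rpow_atTop (s := 1 / 2) (π.card : ℝ) (by norm_num)).isBigO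
    simpa using h2
  have hn : (fun n : ℕ => (π.map (fun p => genHarmonic p n)).prod / (n : ℝ) ^ q)
      =O[Filter.atTop] fun n : ℕ => (n : ℝ) ^ (-(3 / 2) : ℝ) := by
    have hA : (fun n : ℕ => (π.map (fun p => genHarmonic p n)).prod)
        =O[Filter.atTop] fun n : ℕ => (n : ℝ) ^ (1 / 2 : ℝ) := by
      refine Asymptotics.IsBigO.trans ?_ (hlog.comp_tendsto tendsto_natCast_atTop_atTop)
      refine Asymptotics.IsBigO.of_bound 1 (Filter.Eventually.of_forall fun n => ?_)
      obtain ⟨h0, h1⟩ := prod_genHarmonic_bounds π hπ n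
      rw [Real.norm_of_nonneg h0, one_mul]
      exact h1.trans (le_abs_self _)
    have hB : (fun n : ℕ => ((n : ℝ) ^ q)⁻¹)
        =O[Filter.atTop] fun n : ℕ => (n : ℝ) ^ (-2 : ℝ) := by
      refine Asymptotics.IsBigO.of_bound 1 ?_
      filter_upwards [Filter.eventually_ge_atTop 1] with n hn
      have h1 : (1 : ℝ) ≤ n := by exact_mod_cast hn
      rw [Real.norm_of_nonneg (by positivity), Real.norm_of_nonneg (by positivity), one_mul,
        Real.rpow_neg (by positivity), Real.rpow_two]
      exact inv_anti₀ (by positivity) (pow_le_pow_right₀ h1 hq)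
    refine (hA.mul hB).congr' (Filter.Eventually.of_forall fun n => (div_eq_mul_inv _ _).symm) ?_
    filter_upwards [Filter.eventually_ge_atTop 1] with n hn
    have h1 : (0 : ℝ) < n := by exact_mod_cast hn
    rw [← Real.rpow_add h1]
    norm_num
  have hs := summable_of_isBigO_nat (Real.summable_nat_rpow.mpr (by norm_num)) hn
  have := (summable_nat_add_iff 1).mpr hs
  simpa using this

end EulerSums

end

/-!
Summing `H_{n+1}^m - H_n^m`, where `H_n = H_n^{(r)}`, telescopes to `ζ(r)^m`. Expanding `H_n` as
`H_{n+1} - (n+1)^{-r}` turns this into a linear relation between `ζ(r)^m` and the sums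
`S_{r^{m-j}, jr}`; the cases `m = 2, 3, 4` are the closed formulas.

The remaining claims are parity theorems: `S_{a,c}` is a polynomial in zeta values if `a + c` is
odd, and `S_{ab,c}` is reducible to linear sums if `a + b + c` is even. Following Flajolet and
Salvy, let `ψ_a(n) = ∑_{k ≥ 1} (n - k)^{-a}`, which up to zeta values is `H_{n-1}^{(a)}` for `n > 0`
and `± H_{-n}^{(a)}` for `n ≤ 0`. The terms `n` and `-n` of `∑_{n ∈ ℤ} n^{-c} ψ_a(n) ψ_b(n)` then
reinforce each other for the parity in question, which gives twice `S_{ab,c}` plus linear sums. On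
the other hand, interchanging the summations leaves, for fixed `k` and `l`, a sum over `n ∈ ℤ` of
the rational function `n^{-c} (n - k)^{-a} (n - l)^{-b}`, which partial fractions evaluate as a
polynomial in zeta values and the inverse distances of the poles `0`, `k`, `l`. The polar parts of
order one converge only as limits of sums over `|n| ≤ N`, hence the symmetric summation.
-/

namespace EulerSums

open Filter Topology SummationFilter Finset
open scoped LaurentSeries PowerSeries

/-! ### Partial fractions -/

section PartialFractions

variable {K κ : Type*} [Field K]

/-- The linear factor `X + c` as a Laurent series: with `c = u p - u q` it is `x - u q` expressed in
the local coordinate `X = x - u p`. -/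
noncomputable def linearFactor (c : K) : K⸨X⸩ :=
  ((PowerSeries.X + PowerSeries.C c : K⟦X⟧) : K⸨X⸩)

theorem linearFactor_ne_zero (c : K) : linearFactor c ≠ 0 := by
  intro h
  simpa [linearFactor] using congr_arg (fun f : K⸨X⸩ => f.coeff 1) h

theorem linearFactor_sub (c d : K) : linearFactor c - linearFactor d = HahnSeries.C (c - d) := by
  simp [linearFactor]

theorem linearFactor_zero_inv_pow (k : ℕ) :
    (linearFactor (0 : K))⁻¹ ^ k = HahnSeries.single (-k : ℤ) 1 := by
  simp [linearFactor, HahnSeries.inv_single, HahnSeries.single_pow]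

theorem linearFactor_inv {c : K} (hc : c ≠ 0) :
    (linearFactor c)⁻¹ = (((PowerSeries.X + PowerSeries.C c)⁻¹ : K⟦X⟧) : K⸨X⸩) := by
  refine inv_eq_of_mul_eq_one_right ?_
  rw [linearFactor, ← PowerSeries.coe_mul, PowerSeries.mul_inv_cancel _ (by simpa using hc),
    PowerSeries.coe_one]

/-- The value at `x` of the polar part `∑ᵢ f₋ᵢ x⁻ⁱ` of a Laurent series `f`, truncated to `i ≤ N` so
that it is defined by a finite sum that is linear in `f`. -/
noncomputable def polarPart (N : ℕ) (x : K) : K⸨X⸩ →ₗ[K] K :=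
  ∑ i ∈ Icc 1 N, (x ^ i)⁻¹ • HahnSeries.coeff.linearMap (-i : ℤ)

theorem polarPart_apply (N : ℕ) (x : K) (f : K⸨X⸩) :
    polarPart N x f = ∑ i ∈ Icc 1 N, f.coeff (-i) * (x ^ i)⁻¹ := by
  simp [polarPart, mul_comm]

theorem polarPart_coe (N : ℕ) (x : K) (f : K⟦X⟧) : polarPart N x f = 0 := by
  rw [polarPart_apply]
  refine sum_eq_zero fun i hi => ?_
  rw [PowerSeries.coeff_coe, if_pos (by grind), zero_mul]

theorem polarPart_single {N k : ℕ} (hk : k ≠ 0) (hkN : k ≤ N) (x : K) :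
    polarPart N x (HahnSeries.single (-k : ℤ) 1) = (x ^ k)⁻¹ := by
  rw [polarPart_apply, sum_eq_single_of_mem k (by grind)]
  · simp
  · intro i _ hik
    simp [hik]

theorem sum_polarPart_linearFactor_inv_pow [Fintype κ] {u : κ → K} (hu : u.Injective) {N k : ℕ}
    (hk : k ≠ 0) (hkN : k ≤ N) (a : κ) (x : K) :
    ∑ p, polarPart N (x - u p) ((linearFactor (u p - u a))⁻¹ ^ k) = ((x - u a)⁻¹) ^ k := by
  classical
  rw [sum_eq_single_of_mem a (mem_univ a)]
  · rw [sub_self, linearFactor_zero_inv_pow, polarPart_single hk hkN, inv_pow]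
  · intro p _ hpa
    rw [linearFactor_inv (sub_ne_zero.mpr (hu.ne hpa)), ← PowerSeries.coe_pow, polarPart_coe]

theorem linearFactor_inv_mul_sub (c d : K) (f : K⸨X⸩) :
    (linearFactor c)⁻¹ * f - (linearFactor d)⁻¹ * f =
      (d - c) • ((linearFactor c)⁻¹ * ((linearFactor d)⁻¹ * f)) := by
  have hc := linearFactor_ne_zero c
  have hd := linearFactor_ne_zero d
  rw [← HahnSeries.C_mul_eq_smul, ← linearFactor_sub]
  field_simp

theorem polarPart_linearFactor_inv_mul_sub (N : ℕ) (a b p x : K) (f : K⸨X⸩) :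
    (a - b) * polarPart N x ((linearFactor (p - a))⁻¹ * ((linearFactor (p - b))⁻¹ * f)) =
      polarPart N x ((linearFactor (p - a))⁻¹ * f) -
        polarPart N x ((linearFactor (p - b))⁻¹ * f) := by
  rw [← map_sub, linearFactor_inv_mul_sub, map_smul, smul_eq_mul, sub_sub_sub_cancel_left]

/-- Two different poles `a`, `b` are separated by
`(a - b) / ((x - a) (x - b)) = 1 / (x - a) - 1 / (x - b)`, which holds both for the numbers and for
all the local expansions. -/
theorem prod_inv_sub_eq_sum_polarPart [Fintype κ] {u : κ → K} (hu : u.Injective) {S : Multiset κ}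
    {N : ℕ} (hS : S ≠ 0) (hN : S.card ≤ N) {x : K} (hx : ∀ q ∈ S, x ≠ u q) :
    (S.map fun q => (x - u q)⁻¹).prod =
      ∑ p, polarPart N (x - u p) (S.map fun q => (linearFactor (u p - u q))⁻¹).prod := by
  induction hn : S.card generalizing S with
  | zero => simp_all
  | succ n ih =>
    obtain ⟨a, T, rfl⟩ := Multiset.exists_mem_of_ne_zero hS |>.imp fun a =>
      Multiset.exists_cons_of_mem
    by_cases hT : ∀ b ∈ T, b = a
    · rw [Multiset.eq_replicate_card.mpr hT, ← Multiset.replicate_succ]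
      simp only [Multiset.map_replicate, Multiset.prod_replicate]
      rw [sum_polarPart_linearFactor_inv_pow hu (by omega) (by simpa using hN)]
    push Not at hT
    obtain ⟨b, hb, hba⟩ := hT
    obtain ⟨T, rfl⟩ := Multiset.exists_cons_of_mem hb
    simp only [Multiset.mem_cons, forall_eq_or_imp, Multiset.card_cons] at hx hN hn
    have iha := ih (S := a ::ₘ T) (by simp) (by simp; omega) (by simpa using ⟨hx.1, hx.2.2⟩)
      (by simpa using hn)
    have ihb := ih (S := b ::ₘ T) (by simp) (by simp; omega) (by simpa using hx.2)
      (by simpa using hn)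
    have hab : u a - u b ≠ 0 := sub_ne_zero.mpr (hu.ne hba.symm)
    have hxa : x - u a ≠ 0 := sub_ne_zero.mpr hx.1
    have hxb : x - u b ≠ 0 := sub_ne_zero.mpr hx.2.1
    simp only [Multiset.map_cons, Multiset.prod_cons] at iha ihb ⊢
    refine mul_left_cancel₀ hab ?_
    calc (u a - u b) * ((x - u a)⁻¹ * ((x - u b)⁻¹ * (T.map fun q => (x - u q)⁻¹).prod))
        = (x - u a)⁻¹ * (T.map fun q => (x - u q)⁻¹).prod
          - (x - u b)⁻¹ * (T.map fun q => (x - u q)⁻¹).prod := by field_simp; ring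
      _ = _ := by
        simp only [iha, ihb, ← sum_sub_distrib, mul_sum, polarPart_linearFactor_inv_mul_sub]

variable [Fintype κ]

theorem multiset_prod_map_sum_nsmul {M : Type*} [CommMonoid M] (m : κ → ℕ) (g : κ → M) :
    ((∑ q, m q • {q} : Multiset κ).map g).prod = ∏ q, g q ^ m q := by
  rw [← Multiset.coe_mapAddMonoidHom, map_sum, Multiset.prod_sum]
  simp [Multiset.map_nsmul, Multiset.prod_nsmul]

theorem prod_inv_sub_pow_eq_sum_polarPart [Nonempty κ] {u : κ → K} (hu : u.Injective) {m : κ → ℕ}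
    (hm : ∀ q, m q ≠ 0) {x : K} (hx : ∀ q, x ≠ u q) :
    ∏ q, (x - u q)⁻¹ ^ m q =
      ∑ p, polarPart (∑ q, m q) (x - u p) (∏ q, (linearFactor (u p - u q))⁻¹ ^ m q) := by
  simp only [← multiset_prod_map_sum_nsmul]
  refine prod_inv_sub_eq_sum_polarPart hu ?_ (by simp) fun q _ => hx q
  rw [← Multiset.card_pos]
  simpa using sum_pos (fun q _ => Nat.pos_of_ne_zero (hm q)) univ_nonempty

end PartialFractions

/-! ### Symmetric sums over the integers -/

theorem zetaValue_mem {s : ℕ} (hs : 2 ≤ s) : zetaValue s ∈ zetaAlgebra :=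
  Algebra.subset_adjoin ⟨s, hs, rfl⟩

theorem neg_one_pow_mem (i : ℕ) : (-1 : ℝ) ^ i ∈ zetaAlgebra :=
  pow_mem (neg_mem (one_mem _)) i

theorem hasSum_zetaValue {s : ℕ} (hs : 2 ≤ s) :
    HasSum (fun n : ℕ => (((n : ℝ) + 1) ^ s)⁻¹) (zetaValue s) := by
  have h := (summable_nat_add_iff 1).mpr (Real.summable_one_div_nat_pow.mpr (show 1 < s by omega))
  simpa [zetaValue] using h.hasSum

theorem hasSum_symmetricIcc_telescope {E : Type*} [AddCommGroup E] [TopologicalSpace E]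
    [IsTopologicalAddGroup E] {f : ℤ → E} (hf : Tendsto f cofinite (𝓝 0)) :
    HasSum (fun n => f (n + 1) - f n) 0 (symmetricIcc ℤ) := by
  have htele (N : ℕ) : ∑ n ∈ Icc (-N : ℤ) N, (f (n + 1) - f n) = f (N + 1) - f (-N) := by
    induction N with
    | zero => simp
    | succ N ih =>
      rw [Nat.cast_succ, Finset.sum_Icc_succ_eq_add_endpoints, ih]
      grind
  have hpos : Tendsto (fun N : ℕ => f (N + 1)) atTop (𝓝 0) := by
    rw [← Nat.cofinite_eq_atTop]
    exact hf.comp (Function.Injective.tendsto_cofinite fun a b h => by simpa using h)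
  have hneg : Tendsto (fun N : ℕ => f (-N)) atTop (𝓝 0) := by
    rw [← Nat.cofinite_eq_atTop]
    exact hf.comp (Function.Injective.tendsto_cofinite fun a b h => by simpa using h)
  rw [hasSum_symmetricIcc_iff]
  simpa only [htele, sub_zero] using hpos.sub hneg

theorem hasSum_symmetricIcc_shift {E : Type*} [AddCommGroup E] [TopologicalSpace E]
    [IsTopologicalAddGroup E] {f : ℤ → E} {s : E} (hf : Tendsto f cofinite (𝓝 0))
    (hs : HasSum f s (symmetricIcc ℤ)) (e : ℤ) :
    HasSum (fun n => f (n + e)) s (symmetricIcc ℤ) := by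
  have htele (e : ℤ) : HasSum (fun n => f (n + (e + 1)) - f (n + e)) 0 (symmetricIcc ℤ) := by
    simpa [add_right_comm, add_assoc] using hasSum_symmetricIcc_telescope
      (hf.comp (add_left_injective e).tendsto_cofinite)
  induction e with
  | zero => simpa using hs
  | succ e ih => simpa using ih.add (htele e)
  | pred e ih => simpa using ih.sub (htele (-e - 1))

/-- The value of the symmetric sum `lim_N ∑_{0 < |n| ≤ N} n⁻ⁱ`, for `i ≥ 1`. For odd `i` it is
`0`, whatever junk value `zetaValue 1` has. -/
noncomputable def symmZeta (i : ℕ) : ℝ := (1 + (-1) ^ i) * zetaValue i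

theorem tendsto_int_sub_pow_inv {i : ℕ} (hi : i ≠ 0) (e : ℤ) :
    Tendsto (fun n : ℤ => (((n : ℝ) - e) ^ i)⁻¹) cofinite (𝓝 0) := by
  have h : Tendsto (fun n : ℤ => ((n : ℝ))⁻¹) cofinite (𝓝 0) :=
    tendsto_inv₀_cobounded.comp (Metric.cobounded_eq_cocompact (α := ℝ) ▸ Int.tendsto_coe_cofinite)
  simpa [inv_pow, hi, Function.comp_def] using
    (h.comp (sub_left_injective (b := e)).tendsto_cofinite).pow i

theorem neg_pow_inv {K : Type*} [Field K] (x : K) (i : ℕ) :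
    ((-x) ^ i)⁻¹ = (-1) ^ i * (x ^ i)⁻¹ := by
  rw [← inv_pow, inv_neg, neg_pow, inv_pow]

theorem hasSum_inv_pow_symmetricIcc {i : ℕ} (hi : i ≠ 0) :
    HasSum (fun n : ℤ => ((n : ℝ) ^ i)⁻¹) (symmZeta i) (symmetricIcc ℤ) := by
  have hfold (N : ℕ) : ∑ n ∈ Icc (-N : ℤ) N, ((n : ℝ) ^ i)⁻¹ =
      (1 + (-1) ^ i) * ∑ j ∈ range N, (((j : ℝ) + 1) ^ i)⁻¹ := by
    induction N with
    | zero => simp [hi]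
    | succ N ih =>
      rw [Nat.cast_succ, sum_Icc_succ_eq_add_endpoints, ih, sum_range_succ]
      push_cast
      rw [neg_pow_inv]
      ring
  simp only [hasSum_symmetricIcc_iff, hfold]
  obtain rfl | hi' : i = 1 ∨ 2 ≤ i := by omega
  · simp [symmZeta]
  · exact (hasSum_zetaValue hi').tendsto_sum_nat.const_mul _

theorem hasSum_sub_inv_pow_symmetricIcc {i : ℕ} (hi : i ≠ 0) (e : ℤ) :
    HasSum (fun n : ℤ => (((n : ℝ) - e) ^ i)⁻¹) (symmZeta i) (symmetricIcc ℤ) := by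
  have h := hasSum_symmetricIcc_shift (by simpa using tendsto_int_sub_pow_inv hi 0)
    (hasSum_inv_pow_symmetricIcc hi) (-e)
  simpa [sub_eq_add_neg] using h

section Poles

variable {κ : Type*} [Fintype κ]

theorem hasSum_indicator_compl_range {u : κ → ℤ} (hu : u.Injective) {f : ℤ → ℝ} {s : ℝ}
    (hf : HasSum f s (symmetricIcc ℤ)) :
    HasSum ((Set.range u)ᶜ.indicator f) (s - ∑ q, f (u q)) (symmetricIcc ℤ) := by
  have h : HasSum ((Set.range u).indicator f) (∑ q, f (u q)) := by
    refine (hu.hasSum_iff fun n hn => Set.indicator_of_notMem hn f).mp ?_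
    simpa [Function.comp_def] using hasSum_fintype fun q => f (u q)
  rw [Set.indicator_compl]
  exact hf.sub (h.mono_left LeAtTop.le_atTop)

theorem hasSum_polarPart {u : κ → ℤ} (hu : u.Injective) (N : ℕ) (p : κ) (f : ℝ⸨X⸩) :
    HasSum ((Set.range u)ᶜ.indicator fun n : ℤ => polarPart N (n - u p : ℝ) f)
      (∑ i ∈ Icc 1 N, f.coeff (-i) * (symmZeta i - ∑ q, (((u q : ℝ) - u p) ^ i)⁻¹))
      (symmetricIcc ℤ) := by
  have h (i : ℕ) (hi : i ∈ Icc 1 N) := (hasSum_indicator_compl_range hu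
    (hasSum_sub_inv_pow_symmetricIcc (show i ≠ 0 by grind) (u p))).mul_left (f.coeff (-i))
  refine (hasSum_sum h).congr_fun fun n => ?_
  by_cases hn : n ∈ Set.range u
  · simp [Set.indicator_of_notMem (Set.notMem_compl_iff.mpr hn)]
  · simp only [Set.indicator_of_mem (Set.mem_compl hn), polarPart_apply]

theorem hasSum_prod_inv_sub_pow [Nonempty κ] {u : κ → ℤ} (hu : u.Injective) {m : κ → ℕ}
    (hm : ∀ q, m q ≠ 0) :
    HasSum (fun n : ℤ => ∏ q, (n - u q : ℝ)⁻¹ ^ m q)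
      (∑ p, ∑ i ∈ Icc 1 (∑ q, m q),
        (∏ q, (linearFactor (u p - u q : ℝ))⁻¹ ^ m q).coeff (-i) *
          (symmZeta i - ∑ q, (((u q : ℝ) - u p) ^ i)⁻¹)) (symmetricIcc ℤ) := by
  have h (p : κ) := hasSum_polarPart hu (∑ q, m q) p
    (∏ q, (linearFactor (u p - u q : ℝ))⁻¹ ^ m q)
  refine (hasSum_sum fun p _ => h p).congr_fun fun n => ?_
  by_cases hn : n ∈ Set.range u
  · obtain ⟨q, rfl⟩ := hn
    simp [prod_eq_zero (mem_univ q), hm]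
  · simp only [Set.indicator_of_mem (Set.mem_compl hn)]
    exact prod_inv_sub_pow_eq_sum_polarPart (Int.cast_injective.comp hu) hm
      fun q hq => hn ⟨q, Int.cast_injective (α := ℝ) hq.symm⟩

end Poles

section Coefficients

variable {K κ ι : Type*} [Field K]

theorem coeff_X_add_C_inv_pow {s : K} (hs : s ≠ 0) (m j : ℕ) :
    PowerSeries.coeff j ((PowerSeries.X + PowerSeries.C s)⁻¹ ^ m) =
      ((Ring.choose (-m : ℤ) j : ℤ) : K) * (s ^ (m + j))⁻¹ := by
  have hX : PowerSeries.X + PowerSeries.C s =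
      PowerSeries.C s * PowerSeries.rescale s⁻¹ (1 + PowerSeries.X) := by
    rw [map_add, map_one, PowerSeries.rescale_X, mul_add, ← mul_assoc, ← map_mul,
      mul_inv_cancel₀ hs, map_one, one_mul, mul_one, add_comm]
  have hbin : PowerSeries.binomialSeries K (-m : ℤ) * (1 + PowerSeries.X) ^ m = 1 := by
    rw [← PowerSeries.binomialSeries_nat (R := ℤ), ← PowerSeries.binomialSeries_add,
      neg_add_cancel, PowerSeries.binomialSeries_zero]
  have h : (PowerSeries.X + PowerSeries.C s)⁻¹ ^ m =
      PowerSeries.C (s ^ m)⁻¹ *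
        PowerSeries.rescale s⁻¹ (PowerSeries.binomialSeries K (-m : ℤ)) := by
    have h0 : PowerSeries.constantCoeff (PowerSeries.X + PowerSeries.C s) ≠ 0 := by simpa
    have hinv : (PowerSeries.X + PowerSeries.C s)⁻¹ ^ m *
        (PowerSeries.X + PowerSeries.C s) ^ m = 1 := by
      rw [← mul_pow, PowerSeries.inv_mul_cancel _ h0, one_pow]
    refine left_inv_eq_right_inv hinv ?_
    rw [hX, mul_pow, ← map_pow, ← map_pow, mul_mul_mul_comm, ← map_mul, ← map_mul,
      mul_comm _ (PowerSeries.binomialSeries K _), hbin, mul_inv_cancel₀ (pow_ne_zero m hs),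
      map_one, map_one, one_mul]
  rw [h, PowerSeries.coeff_C_mul, PowerSeries.coeff_rescale, PowerSeries.binomialSeries_coeff,
    pow_add, mul_inv, inv_pow s j, zsmul_eq_mul, mul_one]
  ring

theorem sum_fun_mem {A : Type*} [AddCommGroup A] (N : AddSubgroup (ι → A)) {t : Finset κ}
    {f : κ → ι → A} (hf : ∀ q ∈ t, f q ∈ N) : (fun x => ∑ q ∈ t, f q x) ∈ N :=
  sum_fn t f ▸ sum_mem hf

theorem coeff_prod_X_add_C_inv_pow_mul_mem (N : AddSubgroup (ι → K)) {s : κ → ι → K} {Q : Finset κ}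
    (hs : ∀ q ∈ Q, ∀ x, s q x ≠ 0) {m : κ → ℕ}
    (hN : ∀ α, m ≤ α → (fun x => ∏ q ∈ Q, (s q x ^ α q)⁻¹) ∈ N) (β : κ → ℕ) (j : ℕ) :
    (fun x => PowerSeries.coeff j (∏ q ∈ Q, (PowerSeries.X + PowerSeries.C (s q x))⁻¹ ^ m q) *
      ∏ q ∈ Q, (s q x ^ β q)⁻¹) ∈ N := by
  classical
  have h : (fun x => PowerSeries.coeff j
        (∏ q ∈ Q, (PowerSeries.X + PowerSeries.C (s q x))⁻¹ ^ m q) * ∏ q ∈ Q, (s q x ^ β q)⁻¹) =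
      ∑ γ ∈ Q.finsuppAntidiag j, (∏ q ∈ Q, (Ring.choose (-m q : ℤ) (γ q) : ℤ)) •
        fun x => ∏ q ∈ Q, (s q x ^ (m q + γ q + β q))⁻¹ := by
    ext x
    rw [PowerSeries.coeff_prod, sum_mul, Finset.sum_apply]
    refine sum_congr rfl fun γ _ => ?_
    rw [Pi.smul_apply, zsmul_eq_mul, Int.cast_prod, ← prod_mul_distrib, ← prod_mul_distrib]
    refine prod_congr rfl fun q hq => ?_
    rw [coeff_X_add_C_inv_pow (hs q hq x), pow_add _ _ (β q), mul_inv, mul_assoc]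
  rw [h]
  exact sum_mem fun γ _ => zsmul_mem (hN _ fun q => by simp [add_assoc]) _

theorem coeff_prod_linearFactor_inv_pow [Fintype κ] [DecidableEq κ] {s : κ → K}
    {m : κ → ℕ} {p : κ} (hsp : s p = 0) (hs : ∀ q ≠ p, s q ≠ 0) (i : ℕ) :
    (∏ q, (linearFactor (s q))⁻¹ ^ m q).coeff (-i) =
      if i ≤ m p then PowerSeries.coeff (m p - i)
        (∏ q ∈ univ.erase p, (PowerSeries.X + PowerSeries.C (s q))⁻¹ ^ m q) else 0 := by
  have h : ∏ q ∈ univ.erase p, (linearFactor (s q))⁻¹ ^ m q =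
      ((∏ q ∈ univ.erase p, (PowerSeries.X + PowerSeries.C (s q))⁻¹ ^ m q : K⟦X⟧) : K⸨X⸩) := by
    rw [map_prod]
    refine prod_congr rfl fun q hq => ?_
    rw [linearFactor_inv (hs q (ne_of_mem_erase hq)), PowerSeries.coe_pow]
  rw [← mul_prod_erase univ _ (mem_univ p), h, hsp, linearFactor_zero_inv_pow,
    HahnSeries.coeff_single_mul, one_mul, PowerSeries.coeff_coe]
  split_ifs with h1 h2 h2
  · omega
  · rfl
  · congr; omega
  · omega

theorem coeff_prod_linearFactor_inv_pow_mul_mem [Fintype κ] [DecidableEq κ]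
    (N : AddSubgroup (ι → K)) {s : κ → ι → K} {m : κ → ℕ} {p : κ} (hsp : ∀ x, s p x = 0)
    (hs : ∀ q ≠ p, ∀ x, s q x ≠ 0)
    (hN : ∀ α, m ≤ α → (fun x => ∏ q ∈ univ.erase p, (s q x ^ α q)⁻¹) ∈ N) (β : κ → ℕ) (i : ℕ) :
    (fun x => (∏ q, (linearFactor (s q x))⁻¹ ^ m q).coeff (-i) *
      ∏ q ∈ univ.erase p, (s q x ^ β q)⁻¹) ∈ N := by
  simp only [fun x => coeff_prod_linearFactor_inv_pow (m := m) (hsp x) (fun q hq => hs q hq x) i]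
  split_ifs
  · exact coeff_prod_X_add_C_inv_pow_mul_mem N (fun q hq => hs q (ne_of_mem_erase hq)) hN β _
  · simp only [zero_mul]
    exact N.zero_mem

theorem symmZeta_mem {i : ℕ} (hi : i ≠ 0) : symmZeta i ∈ zetaAlgebra := by
  obtain rfl | hi' : i = 1 ∨ 2 ≤ i := by omega
  · simp [symmZeta]
  · exact mul_mem (by simpa using zetaAlgebra.algebraMap_mem (1 + (-1) ^ i)) (zetaValue_mem hi')

theorem mul_fun_mem (N : Submodule zetaAlgebra (ι → ℝ)) {z : ℝ} (hz : z ∈ zetaAlgebra) {f : ι → ℝ}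
    (hf : f ∈ N) : (fun x => z * f x) ∈ N :=
  N.smul_mem ⟨z, hz⟩ hf

theorem tsum_prod_inv_sub_pow_mem [Fintype κ] [Nonempty κ] [DecidableEq κ]
    (N : Submodule zetaAlgebra (ι → ℝ)) {u : κ → ι → ℤ} (hu : ∀ x, (fun q => u q x).Injective)
    {m : κ → ℕ} (hm : ∀ q, m q ≠ 0)
    (hsum : ∀ x, Summable fun n : ℤ => ∏ q, (n - u q x : ℝ)⁻¹ ^ m q)
    (hN : ∀ p α, m ≤ α → (fun x => ∏ q ∈ univ.erase p, ((u p x - u q x : ℝ) ^ α q)⁻¹) ∈ N) :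
    (fun x => ∑' n : ℤ, ∏ q, (n - u q x : ℝ)⁻¹ ^ m q) ∈ N := by
  have htsum (x : ι) := (tsum_eq_of_summable_unconditional (hsum x)).symm.trans
    (hasSum_prod_inv_sub_pow (hu x) hm).tsum_eq
  simp only [htsum, mul_sub, mul_sum]
  have hcoeff (p : κ) := coeff_prod_linearFactor_inv_pow_mul_mem N.toAddSubgroup
    (s := fun q x => (u p x - u q x : ℝ)) (fun x => sub_self _)
    (fun q hq x => sub_ne_zero.mpr (Int.cast_injective.ne ((hu x).ne hq.symm))) (hN p)
  refine sum_fun_mem N.toAddSubgroup fun p _ => sum_fun_mem N.toAddSubgroup fun i hi =>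
    sub_mem ?_ (sum_fun_mem N.toAddSubgroup fun q _ => ?_)
  · simpa [mul_comm] using mul_fun_mem N (symmZeta_mem (show i ≠ 0 by grind)) (hcoeff p 0 i)
  · obtain rfl | hqp := eq_or_ne q p
    · simp only [sub_self, zero_pow (show i ≠ 0 by grind), inv_zero, mul_zero]
      exact N.zero_mem
    · rw [Submodule.mem_toAddSubgroup]
      convert mul_fun_mem N (neg_one_pow_mem i) (hcoeff p (Pi.single q i) i) using 1
      ext x
      rw [prod_eq_single_of_mem (s := univ.erase p) q (by grind)
          fun q' _ hq' => by rw [Pi.single_eq_of_ne hq', pow_zero, inv_one],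
        Pi.single_eq_same, mul_left_comm, ← neg_pow_inv, neg_sub]

end Coefficients

/-! ### Families of terms of convergent series -/

section Series

variable {ι κ : Type*} {M : Submodule zetaAlgebra ℝ}

/-- The families of real numbers whose sum converges to an element of `M`. -/
noncomputable def seriesIn (ι : Type*) (M : Submodule zetaAlgebra ℝ) :
    Submodule zetaAlgebra (ι → ℝ) where
  carrier := {f | Summable f ∧ ∑' i, f i ∈ M}
  zero_mem' := ⟨summable_zero, by simp⟩
  add_mem' := fun {f g} hf hg => ⟨hf.1.add hg.1, by
    simpa only [Pi.add_apply, hf.1.tsum_add hg.1] using M.add_mem hf.2 hg.2⟩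
  smul_mem' := fun z f hf => by
    have h : z • f = fun i => (z : ℝ) * f i := rfl
    refine ⟨h ▸ hf.1.mul_left _, ?_⟩
    rw [h, tsum_mul_left]
    exact M.smul_mem z hf.2

theorem mem_seriesIn_of_hasSum {f : ι → ℝ} {s : ℝ} (h : HasSum f s) (hs : s ∈ M) :
    f ∈ seriesIn ι M :=
  ⟨h.summable, h.tsum_eq.symm ▸ hs⟩

theorem seriesIn_mono {M' : Submodule zetaAlgebra ℝ} (h : M ≤ M') :
    seriesIn ι M ≤ seriesIn ι M' :=
  fun _ hf => ⟨hf.1, h hf.2⟩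

theorem comp_equiv_mem_seriesIn_iff (e : ι ≃ κ) {f : κ → ℝ} :
    f ∘ e ∈ seriesIn ι M ↔ f ∈ seriesIn κ M :=
  and_congr e.summable_iff (by rw [← e.tsum_eq f]; rfl)

theorem tsum_mem_seriesIn_iff {f : ι × κ → ℝ} (hf : Summable f) :
    (fun i => ∑' j, f (i, j)) ∈ seriesIn ι M ↔ f ∈ seriesIn (ι × κ) M := by
  refine and_congr (iff_of_true hf.prod hf) ?_
  rw [hf.tsum_prod]

theorem compl_mem_seriesIn_iff {s : Set ι} {f : ι → ℝ} (hs : f ∘ (↑) ∈ seriesIn s M) :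
    f ∘ (↑) ∈ seriesIn ↥sᶜ M ↔ f ∈ seriesIn ι M := by
  have hsummable : Summable (f ∘ (↑) : ↥sᶜ → ℝ) ↔ Summable f :=
    (and_iff_right hs.1).symm.trans summable_subtype_and_compl
  refine (and_congr_right fun hf => ?_).trans (and_congr_left' hsummable)
  rw [← (hsummable.mp hf).tsum_subtype_add_tsum_subtype_compl s]
  exact (Submodule.add_mem_iff_right M hs.2).symm

theorem compl_diagonal_mem_seriesIn_iff {f : ι × ι → ℝ}
    (hd : (fun i => f (i, i)) ∈ seriesIn ι M) :
    f ∘ (↑) ∈ seriesIn ↥(Set.diagonal ι)ᶜ M ↔ f ∈ seriesIn (ι × ι) M := by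
  have hdiag : Function.Injective fun i : ι => (i, i) := fun i j h => congrArg Prod.fst h
  rw [← Set.range_diag]
  exact compl_mem_seriesIn_iff
    (mem_seriesIn_of_hasSum (hdiag.hasSum_range_iff.mpr hd.1.hasSum) hd.2)

theorem add_neg_mem_seriesIn {f : ℤ → ℝ} (hf : f ∈ seriesIn ℤ M) (h0 : f 0 = 0) :
    (fun m : ℕ => f (m + 1) + f (-(m + 1))) ∈ seriesIn ℕ M := by
  have h := (hasSum_nat_add_iff' 1).mpr hf.1.hasSum.nat_add_neg
  exact mem_seriesIn_of_hasSum (by simpa [h0] using h) hf.2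

end Series

section Kernel

theorem genHarmonic_eq_sum_range (r n : ℕ) :
    genHarmonic r n = ∑ k ∈ range n, (((k : ℝ) + 1) ^ r)⁻¹ := by
  rw [genHarmonic, ← Ico_add_one_right_eq_Icc, sum_Ico_eq_sum_range]
  simp [add_comm]

theorem genHarmonic_succ (r n : ℕ) :
    genHarmonic r (n + 1) = genHarmonic r n + (((n : ℝ) + 1) ^ r)⁻¹ := by
  simp only [genHarmonic_eq_sum_range, sum_range_succ]

theorem summable_int_inv_pow {i : ℕ} (hi : 2 ≤ i) : Summable fun n : ℤ => ((n : ℝ) ^ i)⁻¹ := by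
  simpa using Real.summable_one_div_int_pow.mpr (show 1 < i by omega)

/-- The kernel `∑_{k ≥ 1} (n - k)^{-β}`, up to sign and a factorial the value at `-n` of a
polygamma function. At a pole `n = k` the convention `0⁻¹ = 0` removes the singular summand. -/
noncomputable def kernelSum (β : ℕ) (n : ℤ) : ℝ := ∑' k : ℕ, (((n : ℝ) - (k + 1)) ^ β)⁻¹

variable {β : ℕ} (hβ : 2 ≤ β)
include hβ

theorem hasSum_kernelSum (n : ℤ) :
    HasSum (fun k : ℕ => (((n : ℝ) - (k + 1)) ^ β)⁻¹) (kernelSum β n) := by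
  have hinj : Function.Injective fun k : ℕ => n - (k + 1) := fun k l h => by grind
  refine Summable.hasSum ?_
  simpa [Function.comp_def] using (summable_int_inv_pow hβ).comp_injective hinj

theorem kernelSum_natCast_add_one (m : ℕ) :
    kernelSum β (m + 1) = genHarmonic β m + (-1) ^ β * zetaValue β := by
  have hhead : ∑ k ∈ range (m + 1), (((m + 1 : ℝ) - (k + 1)) ^ β)⁻¹ = genHarmonic β m := by
    rw [sum_range_succ, sub_self, zero_pow (by omega), inv_zero, add_zero, ← sum_range_reflect,
      genHarmonic_eq_sum_range]
    refine sum_congr rfl fun k hk => ?_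
    rw [Nat.cast_sub (by grind), Nat.cast_sub (by grind)]
    push_cast
    ring_nf
  have htail := (hasSum_zetaValue hβ).mul_left ((-1) ^ β)
  have h := (hasSum_nat_add_iff' (m + 1)).mpr (hasSum_kernelSum hβ (m + 1))
  push_cast at h
  rw [hhead] at h
  refine eq_add_of_sub_eq' (h.unique (htail.congr_fun fun k => ?_))
  rw [← neg_pow_inv]
  ring_nf

theorem kernelSum_neg_natCast (m : ℕ) :
    kernelSum β (-m) = (-1) ^ β * (zetaValue β - genHarmonic β m) := by
  have h := ((hasSum_nat_add_iff' m).mpr (hasSum_zetaValue hβ)).mul_left ((-1) ^ β)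
  rw [← genHarmonic_eq_sum_range] at h
  refine ((hasSum_kernelSum hβ (-m)).unique (h.congr_fun fun k => ?_))
  rw [← neg_pow_inv]
  push_cast
  ring_nf

end Kernel

theorem mem_one_iff {x : ℝ} : x ∈ (1 : Submodule zetaAlgebra ℝ) ↔ x ∈ zetaAlgebra := by
  rw [Submodule.mem_one]
  exact ⟨fun ⟨z, hz⟩ => hz ▸ z.2, fun hx => ⟨⟨x, hx⟩, rfl⟩⟩

theorem hasSum_eulerSum {π : Multiset ℕ} (hπ : ∀ p ∈ π, 1 ≤ p) {q : ℕ} (hq : 2 ≤ q) :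
    HasSum (fun n : ℕ => (π.map (fun p => genHarmonic p (n + 1))).prod * (((n : ℝ) + 1) ^ q)⁻¹)
      (eulerSum π q) := by
  simpa only [eulerSum, div_eq_mul_inv] using (summable_eulerSum π hπ q hq).hasSum

theorem eulerSum_singleton_mem {p q : ℕ} (hp : 1 ≤ p) (hq : 2 ≤ q) :
    eulerSum {p} q ∈ linearReducible :=
  Submodule.subset_span (Or.inr ⟨p, q, hp, hq, rfl⟩)

theorem one_le_linearReducible : 1 ≤ linearReducible := by
  rw [Submodule.one_eq_span]
  exact Submodule.span_mono Set.subset_union_left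

theorem mem_linearReducible_of_mem {z : ℝ} (hz : z ∈ zetaAlgebra) : z ∈ linearReducible :=
  one_le_linearReducible (mem_one_iff.mpr hz)

theorem ratCast_mem (q : ℚ) : (q : ℝ) ∈ zetaAlgebra := zetaAlgebra.algebraMap_mem q

theorem inv_pow_mem_seriesIn {s : ℕ} (hs : 2 ≤ s) :
    (fun n : ℕ => (((n : ℝ) + 1) ^ s)⁻¹) ∈ seriesIn ℕ 1 :=
  mem_seriesIn_of_hasSum (hasSum_zetaValue hs) (mem_one_iff.mpr (zetaValue_mem hs))

theorem genHarmonic_mul_inv_pow_mem_seriesIn {p q : ℕ} (hp : 1 ≤ p) (hq : 2 ≤ q) :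
    (fun n : ℕ => genHarmonic p (n + 1) * (((n : ℝ) + 1) ^ q)⁻¹) ∈ seriesIn ℕ linearReducible :=
  mem_seriesIn_of_hasSum (by simpa using hasSum_eulerSum (π := {p}) (by simpa using hp) hq)
    (eulerSum_singleton_mem hp hq)

section Poles

variable {a b c : ℕ}

theorem summable_two_poles (ha : 2 ≤ a) (hc : 2 ≤ c) :
    Summable fun p : ℕ × ℤ => ((p.2 : ℝ) ^ c)⁻¹ * (((p.2 : ℝ) - (p.1 + 1)) ^ a)⁻¹ := by
  have hinj : Function.Injective fun p : ℕ × ℤ => (p.2, p.2 - (p.1 + 1)) := by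
    rintro ⟨k, n⟩ ⟨k', n'⟩ h
    simp only [Prod.mk.injEq] at h ⊢
    omega
  simpa [Function.comp_def] using (summable_mul_of_summable_norm (summable_int_inv_pow hc).norm
    (summable_int_inv_pow ha).norm).comp_injective hinj

theorem tsum_two_poles_mem_seriesIn (ha : 2 ≤ a) (hc : 2 ≤ c) :
    (fun k : ℕ => ∑' n : ℤ, ((n : ℝ) ^ c)⁻¹ * (((n : ℝ) - (k + 1)) ^ a)⁻¹) ∈ seriesIn ℕ 1 := by
  have h := tsum_prod_inv_sub_pow_mem (seriesIn ℕ 1)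
    (u := fun (q : Fin 2) (k : ℕ) => ![0, (k : ℤ) + 1] q) (m := ![c, a]) ?_ ?_ ?_ ?_
  · simpa [Fin.prod_univ_two, mul_comm] using h
  · intro k
    simp [Function.Injective, Fin.forall_fin_two, show (0 : ℤ) ≠ k + 1 by omega,
      show (k : ℤ) + 1 ≠ 0 by omega]
  · simp [Fin.forall_fin_two, show c ≠ 0 by omega, show a ≠ 0 by omega]
  · simpa [Fin.prod_univ_two, mul_comm] using (summable_two_poles ha hc).prod_factor
  · simp only [Fin.forall_fin_two, Pi.le_def]
    refine ⟨fun α hα => ?_, fun α hα => ?_⟩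
    · rw [show univ.erase (0 : Fin 2) = {1} by decide]
      simpa [neg_pow_inv] using
        mul_fun_mem _ (neg_one_pow_mem (α 1)) (inv_pow_mem_seriesIn (ha.trans hα.2))
    · rw [show univ.erase (1 : Fin 2) = {0} by decide]
      simpa using inv_pow_mem_seriesIn (hc.trans hα.1)

theorem kernelSum_mul_inv_pow_mem_seriesIn (ha : 2 ≤ a) (hc : 2 ≤ c) :
    (fun n : ℤ => ((n : ℝ) ^ c)⁻¹ * kernelSum a n) ∈ seriesIn ℤ 1 := by
  simp only [kernelSum, ← tsum_mul_left]
  have h := (tsum_mem_seriesIn_iff (summable_two_poles ha hc)).mp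
    (tsum_two_poles_mem_seriesIn ha hc)
  rw [← comp_equiv_mem_seriesIn_iff (Equiv.prodComm ℤ ℕ)] at h
  exact (tsum_mem_seriesIn_iff h.1).mpr h

theorem summable_three_poles (ha : 2 ≤ a) (hb : 2 ≤ b) (hc : 2 ≤ c) :
    Summable fun p : (ℕ × ℕ) × ℤ => ((p.2 : ℝ) ^ c)⁻¹ *
      ((((p.2 : ℝ) - (p.1.1 + 1)) ^ a)⁻¹ * (((p.2 : ℝ) - (p.1.2 + 1)) ^ b)⁻¹) := by
  have hinj : Function.Injective fun p : (ℕ × ℕ) × ℤ =>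
      (p.2, (p.2 - (p.1.1 + 1), p.2 - (p.1.2 + 1))) := by
    rintro ⟨⟨k, l⟩, n⟩ ⟨⟨k', l'⟩, n'⟩ h
    simp only [Prod.mk.injEq] at h ⊢
    omega
  have hsummable {i : ℕ} (hi : 2 ≤ i) := (summable_int_inv_pow hi).norm
  simpa [Function.comp_def] using (summable_mul_of_summable_norm (hsummable hc)
    (summable_mul_of_summable_norm (hsummable ha) (hsummable hb)).norm).comp_injective hinj

theorem inv_pow_mul_inv_pow_mem_seriesIn {i j : ℕ} (hi : 2 ≤ i) (hj : 2 ≤ j) :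
    (fun p : ℕ × ℕ => (((p.1 : ℝ) + 1) ^ i)⁻¹ * (((p.2 : ℝ) + 1) ^ j)⁻¹) ∈ seriesIn (ℕ × ℕ) 1 := by
  refine mem_seriesIn_of_hasSum ?_ (mem_one_iff.mpr (mul_mem (zetaValue_mem hi) (zetaValue_mem hj)))
  have hsummable := summable_mul_of_summable_norm (hasSum_zetaValue hi).summable.norm
    (hasSum_zetaValue hj).summable.norm
  exact (hasSum_zetaValue hi).mul (hasSum_zetaValue hj) hsummable

theorem inv_pow_mul_sub_inv_pow_mem_seriesIn {i j : ℕ} (hi : 2 ≤ i) (hj : 2 ≤ j) :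
    (fun p : ℕ × ℕ => (((p.1 : ℝ) + 1) ^ i)⁻¹ * (((p.1 : ℝ) - p.2) ^ j)⁻¹) ∈
      seriesIn (ℕ × ℕ) linearReducible := by
  have hinj : Function.Injective fun p : ℕ × ℕ => (p.2, (p.1 : ℤ) + 1) := fun p p' h => by
    grind
  have hsummable : Summable fun p : ℕ × ℕ =>
      (((p.1 : ℝ) + 1) ^ i)⁻¹ * (((p.1 : ℝ) - p.2) ^ j)⁻¹ := by
    simpa [Function.comp_def] using (summable_two_poles hj hi).comp_injective hinj
  refine (tsum_mem_seriesIn_iff hsummable).mp ?_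
  have hrow (k : ℕ) : ∑' l : ℕ, (((k : ℝ) + 1) ^ i)⁻¹ * (((k : ℝ) - l) ^ j)⁻¹ =
      genHarmonic j (k + 1) * (((k : ℝ) + 1) ^ i)⁻¹ +
        ((-1) ^ j * zetaValue j * (((k : ℝ) + 1) ^ i)⁻¹ - (((k : ℝ) + 1) ^ (i + j))⁻¹) := by
    rw [tsum_mul_left, genHarmonic_succ, pow_add]
    have h := kernelSum_natCast_add_one hj k
    simp only [kernelSum, Int.cast_add, Int.cast_natCast, Int.cast_one,
      add_sub_add_right_eq_sub] at h
    rw [h, mul_inv]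
    ring
  simp only [hrow]
  have hζ (s : ℕ) (hs : 2 ≤ s) := seriesIn_mono one_le_linearReducible (inv_pow_mem_seriesIn hs)
  exact add_mem (genHarmonic_mul_inv_pow_mem_seriesIn (by omega) hi) (sub_mem
    (mul_fun_mem _ (mul_mem (neg_one_pow_mem j) (zetaValue_mem hj)) (hζ i hi))
    (hζ (i + j) (by omega)))

theorem inv_pow_mul_inv_pow_mem_seriesIn_compl_diagonal {i j : ℕ} (hi : 2 ≤ i) (hj : 2 ≤ j) :
    (fun p : ↥(Set.diagonal ℕ)ᶜ => (((p.1.1 : ℝ) + 1) ^ i)⁻¹ * (((p.1.2 : ℝ) + 1) ^ j)⁻¹) ∈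
      seriesIn ↥(Set.diagonal ℕ)ᶜ linearReducible := by
  refine seriesIn_mono one_le_linearReducible ((compl_diagonal_mem_seriesIn_iff ?_).mpr
    (inv_pow_mul_inv_pow_mem_seriesIn hi hj))
  simpa only [pow_add, mul_inv] using inv_pow_mem_seriesIn (show 2 ≤ i + j by omega)

theorem comp_val_mem_seriesIn_compl_diagonal {ι : Type*} {M : Submodule zetaAlgebra ℝ}
    {f : ι × ι → ℝ} (hf : f ∈ seriesIn (ι × ι) M) (h0 : ∀ i, f (i, i) = 0) :
    f ∘ (↑) ∈ seriesIn ↥(Set.diagonal ι)ᶜ M := by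
  refine (compl_diagonal_mem_seriesIn_iff ?_).mpr hf
  rw [show (fun i => f (i, i)) = 0 from funext h0]
  exact zero_mem _

theorem tsum_three_poles_mem_seriesIn_compl_diagonal (ha : 2 ≤ a) (hb : 2 ≤ b) (hc : 2 ≤ c) :
    (fun p : ↥(Set.diagonal ℕ)ᶜ => ∑' n : ℤ, ((n : ℝ) ^ c)⁻¹ *
      ((((n : ℝ) - (p.1.1 + 1)) ^ a)⁻¹ * (((n : ℝ) - (p.1.2 + 1)) ^ b)⁻¹)) ∈
        seriesIn ↥(Set.diagonal ℕ)ᶜ linearReducible := by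
  have h := tsum_prod_inv_sub_pow_mem (seriesIn ↥(Set.diagonal ℕ)ᶜ linearReducible)
    (u := fun (q : Fin 3) p => ![0, (p.1.1 : ℤ) + 1, (p.1.2 : ℤ) + 1] q) (m := ![c, a, b])
    ?_ ?_ ?_ ?_
  · simpa [Fin.prod_univ_three, mul_assoc, mul_comm, mul_left_comm] using h
  · rintro ⟨⟨k, l⟩, hkl⟩
    have hkl' : k ≠ l := hkl
    have h0 (k : ℕ) : (0 : ℤ) ≠ k + 1 := by omega
    simp [Function.Injective, Fin.forall_fin_succ, h0, (h0 _).symm, hkl', hkl'.symm]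
  · simp [Fin.forall_fin_succ, show a ≠ 0 ∧ b ≠ 0 ∧ c ≠ 0 by omega]
  · intro p
    simpa [Fin.prod_univ_three, mul_assoc, mul_comm, mul_left_comm] using
      (summable_three_poles ha hb hc).prod_factor p.1
  · intro p α hα
    have h0 : 2 ≤ α 0 := hc.trans (hα 0)
    have h1 : 2 ≤ α 1 := ha.trans (hα 1)
    have h2 : 2 ≤ α 2 := hb.trans (hα 2)
    fin_cases p
    · convert mul_fun_mem _ (neg_one_pow_mem (α 1 + α 2))
        (inv_pow_mul_inv_pow_mem_seriesIn_compl_diagonal h1 h2) using 2 with p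
      simp [show univ.erase (0 : Fin 3) = {1, 2} by decide, neg_pow_inv, pow_add, -mul_inv_rev]
      ring
    · convert comp_val_mem_seriesIn_compl_diagonal
        (inv_pow_mul_sub_inv_pow_mem_seriesIn h0 h2)
        (fun k => by simp [show α 2 ≠ 0 by omega]) using 2 with p
      simp [show univ.erase (1 : Fin 3) = {0, 2} by decide, mul_comm]
    · convert comp_val_mem_seriesIn_compl_diagonal ((comp_equiv_mem_seriesIn_iff
        (Equiv.prodComm ℕ ℕ)).mpr (inv_pow_mul_sub_inv_pow_mem_seriesIn h0 h1))
        (fun k => by simp [show α 1 ≠ 0 by omega]) using 2 with p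
      simp [show univ.erase (2 : Fin 3) = {0, 1} by decide, mul_comm]

theorem tsum_three_poles_mem_seriesIn (ha : 2 ≤ a) (hb : 2 ≤ b) (hc : 2 ≤ c) :
    (fun p : ℕ × ℕ => ∑' n : ℤ, ((n : ℝ) ^ c)⁻¹ *
      ((((n : ℝ) - (p.1 + 1)) ^ a)⁻¹ * (((n : ℝ) - (p.2 + 1)) ^ b)⁻¹)) ∈
        seriesIn (ℕ × ℕ) linearReducible := by
  refine (compl_diagonal_mem_seriesIn_iff ?_).mp
    (tsum_three_poles_mem_seriesIn_compl_diagonal ha hb hc)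
  simpa only [pow_add, mul_inv] using seriesIn_mono one_le_linearReducible
    (tsum_two_poles_mem_seriesIn (show 2 ≤ a + b by omega) hc)

theorem kernelSum_mul_kernelSum_mul_inv_pow_mem_seriesIn (ha : 2 ≤ a) (hb : 2 ≤ b) (hc : 2 ≤ c) :
    (fun n : ℤ => ((n : ℝ) ^ c)⁻¹ * (kernelSum a n * kernelSum b n)) ∈
      seriesIn ℤ linearReducible := by
  have h := (tsum_mem_seriesIn_iff (summable_three_poles ha hb hc)).mp
    (tsum_three_poles_mem_seriesIn ha hb hc)
  rw [← comp_equiv_mem_seriesIn_iff (Equiv.prodComm ℤ (ℕ × ℕ))] at h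
  have hmul (n : ℤ) := tsum_mul_tsum_of_summable_norm (hasSum_kernelSum ha n).summable.norm
    (hasSum_kernelSum hb n).summable.norm
  simp only [kernelSum, hmul, ← tsum_mul_left]
  exact (tsum_mem_seriesIn_iff h.1).mpr h

end Poles

/-! ### Parity theorems -/

theorem eulerSum_mem_of_mem_seriesIn {π : Multiset ℕ} {q : ℕ} {M : Submodule zetaAlgebra ℝ}
    (h : (fun n : ℕ => (π.map fun p => genHarmonic p (n + 1)).prod * (((n : ℝ) + 1) ^ q)⁻¹) ∈
      seriesIn ℕ M) : eulerSum π q ∈ M := by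
  simpa only [eulerSum, div_eq_mul_inv] using h.2

theorem eulerSum_singleton_mem_zetaAlgebra {a c : ℕ} (ha : 2 ≤ a) (hc : 2 ≤ c)
    (hodd : Odd (a + c)) : eulerSum {a} c ∈ zetaAlgebra := by
  have hfold := add_neg_mem_seriesIn (kernelSum_mul_inv_pow_mem_seriesIn ha hc)
    (by simp [show c ≠ 0 by omega])
  have hz : (1 - (-1) ^ a) * zetaValue a ∈ zetaAlgebra :=
    mul_mem (sub_mem (one_mem _) (neg_one_pow_mem a)) (zetaValue_mem ha)
  refine mem_one_iff.mp (eulerSum_mem_of_mem_seriesIn ?_)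
  convert mul_fun_mem _ (ratCast_mem (1 / 2)) (add_mem hfold (add_mem
    (inv_pow_mem_seriesIn (show 2 ≤ a + c by omega))
    (mul_fun_mem _ hz (inv_pow_mem_seriesIn hc)))) using 2 with m
  have hneg := kernelSum_neg_natCast ha (m + 1)
  have hsign : (-1 : ℝ) ^ a * (-1) ^ c = -1 := by rw [← pow_add, hodd.neg_one_pow]
  push_cast at hneg
  simp only [Pi.add_apply, kernelSum_natCast_add_one ha, hneg, genHarmonic_succ, pow_add, mul_inv,
    Multiset.map_singleton, Multiset.prod_singleton]
  push_cast
  rw [neg_pow_inv]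
  linear_combination (-1 / 2) * ((m + 1 : ℝ) ^ c)⁻¹ *
    (zetaValue a - (genHarmonic a m + ((m + 1 : ℝ) ^ a)⁻¹)) * hsign

theorem eulerSum_pair_mem_linearReducible {a b c : ℕ} (ha : 2 ≤ a) (hb : 2 ≤ b) (hc : 2 ≤ c)
    (heven : Even (a + b + c)) : eulerSum {a, b} c ∈ linearReducible := by
  have hfold := add_neg_mem_seriesIn (kernelSum_mul_kernelSum_mul_inv_pow_mem_seriesIn ha hb hc)
    (by simp [show c ≠ 0 by omega])
  have hζ {s : ℕ} (hs : 2 ≤ s) := seriesIn_mono one_le_linearReducible (inv_pow_mem_seriesIn hs)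
  have hεζ {s : ℕ} (hs : 2 ≤ s) : (-1) ^ s * zetaValue s ∈ zetaAlgebra :=
    mul_mem (neg_one_pow_mem s) (zetaValue_mem hs)
  have hlinear {s t : ℕ} (hs : 2 ≤ s) (ht : 2 ≤ t) := sub_mem
    (mul_fun_mem _ (sub_mem (hεζ ht) (zetaValue_mem ht))
      (genHarmonic_mul_inv_pow_mem_seriesIn (show 1 ≤ s by omega) hc))
    (genHarmonic_mul_inv_pow_mem_seriesIn (show 1 ≤ s by omega) (show 2 ≤ t + c by omega))
  have hzeta {s t : ℕ} (hs : 2 ≤ s) (ht : 2 ≤ t) :=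
    mul_fun_mem _ (hεζ hs) (hζ (show 2 ≤ t + c by omega))
  have hconst := mul_fun_mem _ (add_mem (mul_mem (hεζ ha) (hεζ hb))
    (mul_mem (zetaValue_mem ha) (zetaValue_mem hb))) (hζ hc)
  refine eulerSum_mem_of_mem_seriesIn ?_
  convert mul_fun_mem _ (ratCast_mem (1 / 2)) (sub_mem hfold (add_mem (add_mem (hlinear ha hb)
    (hlinear hb ha)) (add_mem (sub_mem (sub_mem (hζ (show 2 ≤ a + b + c by omega)) (hzeta hb ha))
    (hzeta ha hb)) hconst))) using 2 with m
  have hneg {s : ℕ} (hs : 2 ≤ s) := kernelSum_neg_natCast hs (m + 1)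
  have hsign : (-1 : ℝ) ^ a * (-1) ^ b * (-1) ^ c = 1 := by
    rw [← pow_add, ← pow_add, heven.neg_one_pow]
  push_cast at hneg
  simp only [Pi.add_apply, Pi.sub_apply, kernelSum_natCast_add_one ha,
    kernelSum_natCast_add_one hb, hneg ha, hneg hb, genHarmonic_succ, pow_add, mul_inv,
    Multiset.insert_eq_cons, Multiset.map_cons, Multiset.prod_cons, Multiset.map_singleton,
    Multiset.prod_singleton]
  push_cast
  rw [neg_pow_inv]
  linear_combination (-1 / 2) * ((m + 1 : ℝ) ^ c)⁻¹ *
    (zetaValue a - (genHarmonic a m + ((m + 1 : ℝ) ^ a)⁻¹)) *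
    (zetaValue b - (genHarmonic b m + ((m + 1 : ℝ) ^ b)⁻¹)) * hsign

/-! ### Powers of zeta values -/

theorem tendsto_genHarmonic {r : ℕ} (hr : 2 ≤ r) :
    Tendsto (genHarmonic r) atTop (𝓝 (zetaValue r)) := by
  simpa only [← genHarmonic_eq_sum_range] using (hasSum_zetaValue hr).tendsto_sum_nat

theorem eulerSum_zero (q : ℕ) : eulerSum 0 q = zetaValue q := by
  simp [eulerSum, zetaValue]

theorem genHarmonic_pow_succ_sub (r m n : ℕ) :
    genHarmonic r (n + 1) ^ (m + 1) - genHarmonic r n ^ (m + 1) =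
      ∑ j ∈ range (m + 1), (-1) ^ j * (m + 1).choose (j + 1) *
        (genHarmonic r (n + 1) ^ (m - j) * (((n : ℝ) + 1) ^ ((j + 1) * r))⁻¹) := by
  have h : genHarmonic r n = -(((n : ℝ) + 1) ^ r)⁻¹ + genHarmonic r (n + 1) := by
    rw [genHarmonic_succ]
    ring
  rw [h, add_pow, sum_range_succ', pow_zero, one_mul, Nat.sub_zero, Nat.choose_zero_right,
    Nat.cast_one, mul_one, sub_add_cancel_right, ← sum_neg_distrib]
  refine sum_congr rfl fun j _ => ?_
  rw [neg_pow, ← inv_pow, ← inv_pow, pow_mul', inv_pow, pow_succ (-1 : ℝ), Nat.add_sub_add_right]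
  ring

theorem zetaValue_pow_succ {r : ℕ} (hr : 2 ≤ r) (m : ℕ) :
    zetaValue r ^ (m + 1) = ∑ j ∈ range (m + 1), (-1) ^ j * (m + 1).choose (j + 1) *
      eulerSum (Multiset.replicate (m - j) r) ((j + 1) * r) := by
  have hterm (j : ℕ) := (hasSum_eulerSum (π := Multiset.replicate (m - j) r)
    (fun p hp => Multiset.eq_of_mem_replicate hp ▸ by omega)
    (show 2 ≤ (j + 1) * r by nlinarith)).mul_left ((-1) ^ j * ((m + 1).choose (j + 1) : ℝ))
  simp only [Multiset.map_replicate, Multiset.prod_replicate] at hterm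
  have hsum := (hasSum_sum fun j (_ : j ∈ range (m + 1)) => hterm j).tendsto_sum_nat
  simp only [← genHarmonic_pow_succ_sub, sum_range_sub fun n => genHarmonic r n ^ (m + 1)] at hsum
  refine tendsto_nhds_unique (((tendsto_genHarmonic hr).pow (m + 1)).congr fun N => ?_) hsum
  simp [genHarmonic]

theorem eulerSum_singleton_self {r : ℕ} (hr : 2 ≤ r) :
    eulerSum {r} r = (1 / 2 : ℚ) • (zetaValue r ^ 2 + zetaValue (2 * r)) := by
  have h : zetaValue r ^ 2 = 2 * eulerSum {r} r - zetaValue (2 * r) := by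
    simpa [sum_range_succ, eulerSum_zero, sub_eq_add_neg] using zetaValue_pow_succ hr 1
  rw [h, Rat.smul_def]
  push_cast
  ring

theorem eulerSum_pair_self {r : ℕ} (hr : 2 ≤ r) :
    eulerSum {r, r} r =
      (1 / 3 : ℚ) • (zetaValue r ^ 3 - zetaValue (3 * r)) + eulerSum {r} (2 * r) := by
  have h : zetaValue r ^ 3 =
      3 * eulerSum {r, r} r - 3 * eulerSum {r} (2 * r) + zetaValue (3 * r) := by
    simpa [sum_range_succ, eulerSum_zero, Multiset.replicate_succ, sub_eq_add_neg] using
      zetaValue_pow_succ hr 2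
  rw [h, Rat.smul_def]
  push_cast
  ring

theorem eulerSum_triple_self {r : ℕ} (hr : 2 ≤ r) :
    eulerSum {r, r, r} r = (1 / 4 : ℚ) • (zetaValue r ^ 4 + zetaValue (4 * r))
      - eulerSum {r} (3 * r) + (3 / 2 : ℚ) • eulerSum {r, r} (2 * r) := by
  have h : zetaValue r ^ 4 = 4 * eulerSum {r, r, r} r - 6 * eulerSum {r, r} (2 * r)
      + 4 * eulerSum {r} (3 * r) - zetaValue (4 * r) := by
    simpa [sum_range_succ, eulerSum_zero, Multiset.replicate_succ, sub_eq_add_neg,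
      show Nat.choose 4 2 = 6 from rfl, show (-1 : ℝ) ^ 3 = -1 by norm_num] using
      zetaValue_pow_succ hr 3
  rw [h, Rat.smul_def, Rat.smul_def]
  push_cast
  ring

end EulerSums

theorem mainTheorem11 (r : ℕ) (hr : 2 ≤ r) :
    EulerSums.eulerSum {r, r} r =
        1 / 3 * EulerSums.zetaValue r ^ 3 - 1 / 3 * EulerSums.zetaValue (3 * r)
          + EulerSums.eulerSum {r} (2 * r) ∧
    EulerSums.eulerSum {r, r, r} r =
        1 / 4 * EulerSums.zetaValue r ^ 4 + 3 / 4 * EulerSums.zetaValue (2 * r) ^ 2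
          + EulerSums.zetaValue (4 * r) - EulerSums.eulerSum {r} (3 * r)
          + 3 / 2 * EulerSums.eulerSum {r, r} (2 * r)
          - 3 / 2 * EulerSums.eulerSum {2 * r} (2 * r) ∧
    EulerSums.eulerSum {r, r} r ∈ EulerSums.linearReducible ∧
    EulerSums.eulerSum {r, r, r} r ∈ EulerSums.linearReducible ∧
    (Odd r → EulerSums.eulerSum {r, r} r ∈ EulerSums.zetaAlgebra) := by
  open EulerSums in
  have hS₁ := eulerSum_singleton_self (show 2 ≤ 2 * r by omega)
  have hS₂ := eulerSum_pair_self hr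
  have hS₃ := eulerSum_triple_self hr
  have hlin {q : ℕ} (hq : 2 ≤ q) := eulerSum_singleton_mem (show 1 ≤ r by omega) hq
  have hquad : eulerSum {r, r} (2 * r) ∈ linearReducible :=
    eulerSum_pair_mem_linearReducible hr hr (by omega) ⟨2 * r, by ring⟩
  have hP₂ := zetaAlgebra.smul_mem
    (sub_mem (pow_mem (zetaValue_mem hr) 3) (zetaValue_mem (show 2 ≤ 3 * r by omega))) (1 / 3)
  have hP₃ := zetaAlgebra.smul_mem
    (add_mem (pow_mem (zetaValue_mem hr) 4) (zetaValue_mem (show 2 ≤ 4 * r by omega))) (1 / 4)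
  refine ⟨?_, ?_, ?_, ?_, fun hodd => ?_⟩
  · rw [hS₂, Rat.smul_def]
    push_cast
    ring
  · rw [hS₃, hS₁, show 2 * (2 * r) = 4 * r by ring]
    simp only [Rat.smul_def]
    push_cast
    ring
  · exact hS₂ ▸ add_mem (mem_linearReducible_of_mem hP₂) (hlin (by omega))
  · exact hS₃ ▸ add_mem (sub_mem (mem_linearReducible_of_mem hP₃) (hlin (by omega)))
      (linearReducible.smul_of_tower_mem (3 / 2 : ℚ) hquad)
  · exact hS₂ ▸ add_mem hP₂ (eulerSum_singleton_mem_zetaAlgebra hr (by omega)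
      (hodd.add_even (even_two_mul r)))
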